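/- Write $q=e^{2\pi i z}$ and $q^{s}=e^{2\pi i s z}$ for $z$ in the upper half-plane $\mathbb H$, and let $$E_4(z)=1+240\sum_{m\ge1}\Big(\sum_{d\mid m}d^3\Big)q^m,\qquad E_6(z)=1-504\sum_{m\ge1}\Big(\sum_{d\mid m}d^5\Big)q^m,$$ $$\Delta=\frac{E_4^3-E_6^2}{1728},\qquad j=\frac{E_4^3}{\Delta},\qquad \Delta(z)^{1/2}=q^{1/2}\prod_{m\ge1}(1-q^m)^{12}.$$ Let $n$ be a positive odd integer and $Q(z)=-\pi^2(n/2)^2E_4(z)$. Then there are holomorphic solutions $$y_\pm(z)=q^{\pm n/4}\Big(1+\sum_{m\ge1}c_m^{\pm}q^m\Big)$$ on $\mathbb H$ of the differential equation $y''(z)=Q(z)y(z)$ (where $'=d/dz$), and a constant $c\in\mathbb C$, such that $F(z)=y_-(z)^2+c\,y_+(z)^2$ satisfies $$F(z+1)=-F(z),\qquad z^{2}F(-1/z)=-F(z)\qquad(z\in\mathbb H).$$ Moreover, for every function $F$ of this kind there is a polynomial $P\in\mathbb Q[x]$ of degree $(n-1)/2$ such that $$F(z)=\frac{E_4(z)}{\Delta(z)^{1/2}}\,P(j(z))\qquad\text{for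 all } z\in\mathbb H.$$ -/

import Mathlib

open UpperHalfPlane ModularForm
open scoped Real MatrixGroups Manifold

noncomputable section

namespace ModularODE

/-- `q ^ s = exp (2 π i s z)` for `q = exp (2 π i z)`. -/
def qPow (s : ℂ) (z : ℍ) : ℂ := Complex.exp (2 * π * Complex.I * s * z)

/-- `y` is a holomorphic solution on the upper half-plane of `y'' = Q y`, where `'` is `d/dz`.
(`y ∘ ofComplex` is `y` regarded as a function of a complex variable; it agrees with `y` on the
open upper half-plane, where the derivatives are taken.) -/
def IsSolution (Q y : ℍ → ℂ) : Prop :=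
  MDiff y ∧ ∀ z : ℍ, iteratedDeriv 2 (y ∘ ofComplex) (z : ℂ) = Q z * y z

/-- `y = q ^ s * (1 + ∑_{m ≥ 1} a_m q ^ m)`, the series converging on the whole upper half-plane. -/
def HasNormalizedExpansion (s : ℂ) (y : ℍ → ℂ) : Prop :=
  ∃ a : ℕ → ℂ, a 0 = 1 ∧ ∀ z : ℍ, HasSum (fun m : ℕ ↦ a m * qPow (s + m) z) (y z)

/-- `F = y₋ ^ 2 + c y₊ ^ 2` for some constant `c` and solutions
`y₋ = q ^ (-n/4) * (1 + ⋯)`, `y₊ = q ^ (n/4) * (1 + ⋯)` of `y'' = Q y`, and `F` satisfies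
`F|₋₂ T = F|₋₂ S = -F` for `T = (1, 1; 0, 1)` and `S = (0, -1; 1, 0)`. -/
def IsAntiInvariantSquareSum (Q : ℍ → ℂ) (n : ℕ) (F : ℍ → ℂ) : Prop :=
  ∃ (yMinus yPlus : ℍ → ℂ) (c : ℂ),
    (IsSolution Q yMinus ∧ HasNormalizedExpansion (-(n : ℂ) / 4) yMinus) ∧
    (IsSolution Q yPlus ∧ HasNormalizedExpansion ((n : ℂ) / 4) yPlus) ∧
    (∀ z : ℍ, F z = yMinus z ^ 2 + c * yPlus z ^ 2) ∧
    F ∣[(-2 : ℤ)] ModularGroup.T = -F ∧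
    F ∣[(-2 : ℤ)] ModularGroup.S = -F

/-- The potential `Q(z) = -π² (n/2)² E₄(z)`. -/
def potential (n : ℕ) (z : ℍ) : ℂ := -(π : ℂ) ^ 2 * ((n : ℂ) / 2) ^ 2 * E₄ z

/-- The holomorphic square root `Δ^{1/2} = η¹² = q^{1/2} ∏_{m ≥ 1} (1 - q^m)^{12}`. -/
def sqrtDelta (z : ℍ) : ℂ := eta z ^ 12

/-- The modular function `j = E₄³ / Δ`. -/
def kleinJ (z : ℍ) : ℂ := E₄ z ^ 3 / discriminant z

/-- `sqrtDelta` is a square root of `Δ = (E₄³ - E₆²) / 1728`. -/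
theorem sqrtDelta_sq (z : ℍ) :
    sqrtDelta z ^ 2 = discriminant z ∧
      discriminant z = (E₄ z ^ 3 - E₆ z ^ 2) / 1728 :=
  ⟨by simp only [sqrtDelta, discriminant]; ring, discriminant_eq_E₄_cube_sub_E₆_sq z⟩

/-- The product formula fixing the branch of `sqrtDelta`. -/
theorem sqrtDelta_eq (z : ℍ) :
    sqrtDelta z = qPow (1 / 2) z * (∏' m : ℕ, (1 - qPow (m + 1) z)) ^ 12 := by
  have h : ∀ m : ℕ, eta_q m z = qPow (m + 1) z := fun m ↦ eta_q_eq_cexp m z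
  have h' : (Function.Periodic.qParam 24 z) ^ 12 = qPow (1 / 2) z := by
    rw [Function.Periodic.qParam, qPow, ← Complex.exp_nat_mul]
    congr 1
    push_cast
    ring
  simp only [sqrtDelta, eta, mul_pow, h, h']

/-- The Fourier expansion of `E₄`. -/
theorem E₄_eq (z : ℍ) :
    E₄ z = 1 + 240 * ∑' m : ℕ+, (∑ d ∈ (m : ℕ).divisors, (d : ℂ) ^ 3) * qPow (m : ℂ) z := by
  have hb : bernoulli 4 = -1 / 30 := by
    rw [bernoulli_eq_bernoulli'_of_ne_one (by norm_num)]
    exact bernoulli'_four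
  have := EisensteinSeries.q_expansion_bernoulli (k := 4) (by norm_num) (by decide) z
  rw [this, hb]
  have hc : -(2 * ((4 : ℕ) : ℂ) / (((-1 / 30 : ℚ)) : ℂ)) = 240 := by norm_num
  rw [sub_eq_add_neg, ← neg_mul, hc]
  congr 2
  refine tsum_congr fun m ↦ ?_
  rw [ArithmeticFunction.sigma_apply]
  push_cast
  congr 1
  rw [qPow, zpow_natCast, ← Complex.exp_nat_mul]
  congr 1
  ring

end ModularODE

end

/-! The potential has weight 4, so the solution space is stable under the weight -1 action of the
modular group, and the task is to find a quadratic form in the solutions on which `T` and `S` act by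
-1. The exponents ±n/4 differ by n/2, which is not an integer for odd n. There is thus no resonance:
the Frobenius recursion yields both solutions (`exists_solution`) and forces their coefficients to
be rational (`IsSolution.exists_rational_series`), while `T` acts on each square by exp(±πin) = -1.
In the basis y₋, y₊ the inversion has a matrix (a, b; c, d) of square -1. Here c ≠ 0, since
otherwise y₊⁴ would be a nonzero level one form of weight -4. Hence the trace vanishes and y₋² +
(b/c) y₊² is anti-invariant (`IsBasis.exists_square_sum`).

For the polynomial, write n = 2l + 1 and G = F Δ^{1/2} Δ^l. The signs cancel, and Δ^{n/2}
compensates the pole q^{-n/2}, so G is a level one form of weight 12l + 4. Splitting off powers of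
E₄ and dividing by Δ repeatedly gives G = E₄ Δ^l P(j), where P depends rationally on the first l + 1
coefficients of G (`exists_polynomial`). The constant multiplying y₊², about which nothing
arithmetic is known, enters G only from q^n onwards, and l < n; so P is rational. Its leading
coefficient is the constant term ±1 of G. -/

namespace ModularODE

open Filter Topology Function

/-! ### Complex derivatives and `q`-series on the upper half-plane. -/

/-- `A` is a `q`-expansion of `f`, converging on the whole upper half-plane. -/
def HasQSeries (f : ℍ → ℂ) (A : PowerSeries ℂ) : Prop :=
  ∀ z : ℍ, HasSum (fun m : ℕ ↦ A.coeff m * Periodic.qParam 1 z ^ m) (f z)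

/-- `f'` is the derivative of `f` on the upper half-plane. -/
def HasComplexDeriv (f f' : ℍ → ℂ) : Prop :=
  ∀ z : ℍ, HasDerivAt (f ∘ ofComplex) (f' z) (z : ℂ)

theorem qPow_natCast (m : ℕ) (z : ℍ) : qPow m z = Periodic.qParam 1 z ^ m := by
  rw [qPow, Periodic.qParam, ← Complex.exp_nat_mul]
  congr 1
  push_cast
  ring

theorem qPow_add (s t : ℂ) (z : ℍ) : qPow (s + t) z = qPow s z * qPow t z := by
  rw [qPow, qPow, qPow, ← Complex.exp_add]
  congr 1
  ring

theorem qPow_zero (z : ℍ) : qPow 0 z = 1 := by simp [qPow]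

theorem qPow_ne_zero (s : ℂ) (z : ℍ) : qPow s z ≠ 0 := Complex.exp_ne_zero _

theorem qPow_pow (s : ℂ) (k : ℕ) (z : ℍ) : qPow s z ^ k = qPow (k * s) z := by
  rw [qPow, qPow, ← Complex.exp_nat_mul]
  congr 1
  ring

namespace HasComplexDeriv

variable {f g f' g' : ℍ → ℂ}

theorem add (hf : HasComplexDeriv f f') (hg : HasComplexDeriv g g') :
    HasComplexDeriv (fun z ↦ f z + g z) (fun z ↦ f' z + g' z) :=
  fun z ↦ (hf z).add (hg z)

theorem sub (hf : HasComplexDeriv f f') (hg : HasComplexDeriv g g') :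
    HasComplexDeriv (fun z ↦ f z - g z) (fun z ↦ f' z - g' z) :=
  fun z ↦ (hf z).sub (hg z)

theorem mul (hf : HasComplexDeriv f f') (hg : HasComplexDeriv g g') :
    HasComplexDeriv (fun z ↦ f z * g z) (fun z ↦ f' z * g z + f z * g' z) := by
  intro z
  have := (hf z).mul (hg z)
  simpa [Function.comp_def, Pi.mul_def, ofComplex_apply] using this

theorem const_mul (c : ℂ) (hf : HasComplexDeriv f f') :
    HasComplexDeriv (fun z ↦ c * f z) (fun z ↦ c * f' z) :=
  fun z ↦ (hf z).const_mul c

theorem mdiff (hf : HasComplexDeriv f f') : MDiff f :=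
  fun z ↦ mdifferentiableAt_iff.mpr (hf z).differentiableAt

theorem unique (hf : HasComplexDeriv f f') (hg : HasComplexDeriv f g') : f' = g' :=
  funext fun z ↦ (hf z).unique (hg z)

theorem deriv_eq (hf : HasComplexDeriv f f') (z : ℍ) : deriv (f ∘ ofComplex) z = f' z :=
  (hf z).deriv

theorem eq_const (hf : HasComplexDeriv f 0) : ∃ c, ∀ z, f z = c := by
  refine ⟨f I, fun z ↦ ?_⟩
  have hconv : Convex ℝ {w : ℂ | 0 < w.im} := convex_halfSpace_im_gt 0
  have h := hconv.is_const_of_fderivWithin_eq_zero (𝕜 := ℂ) (f := f ∘ ofComplex)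
    (fun w hw ↦ (hf ⟨w, hw⟩).differentiableAt.differentiableWithinAt)
    (fun w hw ↦ by
      have h1 := (hf ⟨w, hw⟩).hasFDerivAt.hasFDerivWithinAt (s := {w : ℂ | 0 < w.im})
      have hu : UniqueDiffWithinAt ℂ {w : ℂ | 0 < w.im} w :=
        isOpen_upperHalfPlaneSet.uniqueDiffWithinAt hw
      rw [h1.fderivWithin hu]
      ext
      simp)
    z.im_pos I.im_pos
  simpa only [Function.comp_apply, ofComplex_apply] using h

end HasComplexDeriv

theorem hasComplexDeriv_of_mdiff {f : ℍ → ℂ} (hf : MDiff f) :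
    HasComplexDeriv f fun z ↦ deriv (f ∘ ofComplex) z :=
  fun z ↦ (mdifferentiableAt_iff.mp (hf z)).hasDerivAt

theorem deriv_comp_ofComplex_eventuallyEq (f : ℍ → ℂ) (z : ℍ) :
    (fun w : ℍ ↦ deriv (f ∘ ofComplex) w) ∘ ofComplex =ᶠ[𝓝 (z : ℂ)] deriv (f ∘ ofComplex) := by
  filter_upwards [isOpen_upperHalfPlaneSet.mem_nhds z.2] with w hw
  simp [ofComplex_apply_of_im_pos hw]

theorem isSolution_iff {Q y : ℍ → ℂ} :
    IsSolution Q y ↔ ∃ y' : ℍ → ℂ, HasComplexDeriv y y' ∧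
      HasComplexDeriv y' fun z ↦ Q z * y z := by
  constructor
  · rintro ⟨hy, h2⟩
    refine ⟨_, hasComplexDeriv_of_mdiff hy, fun z ↦ ?_⟩
    refine HasDerivAt.congr_of_eventuallyEq ?_ (deriv_comp_ofComplex_eventuallyEq y z)
    change HasDerivAt _ (Q z * y z) _
    rw [← h2 z, iteratedDeriv_succ, iteratedDeriv_one]
    exact ((UpperHalfPlane.mdifferentiable_iff.mp hy).deriv isOpen_upperHalfPlaneSet).differentiableAt
      (isOpen_upperHalfPlaneSet.mem_nhds z.2) |>.hasDerivAt
  · rintro ⟨y', h1, h2⟩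
    refine ⟨h1.mdiff, fun z ↦ ?_⟩
    rw [iteratedDeriv_succ, iteratedDeriv_one]
    have hy' : y' = fun z : ℍ ↦ deriv (y ∘ ofComplex) z := funext fun z ↦ (h1.deriv_eq z).symm
    rw [← h2.deriv_eq z, hy']
    exact (deriv_comp_ofComplex_eventuallyEq y z).symm.deriv_eq

theorem hasComplexDeriv_qPow (s : ℂ) :
    HasComplexDeriv (qPow s) fun z ↦ 2 * π * Complex.I * s * qPow s z := by
  intro z
  have h : HasDerivAt (fun w : ℂ ↦ Complex.exp (2 * π * Complex.I * s * w))
      (Complex.exp (2 * π * Complex.I * s * z) * (2 * π * Complex.I * s * 1)) z :=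
    ((hasDerivAt_id (z : ℂ)).const_mul (2 * π * Complex.I * s)).cexp
  rw [mul_one, mul_comm (Complex.exp _)] at h
  refine h.congr_of_eventuallyEq ?_
  filter_upwards [isOpen_upperHalfPlaneSet.mem_nhds z.2] with w hw
  simp [ofComplex_apply_of_im_pos hw, qPow]

theorem qParam_vadd (z : ℍ) :
    Periodic.qParam 1 ((1 : ℝ) +ᵥ z : ℍ) = Periodic.qParam 1 (z : ℂ) := by
  simp only [Periodic.qParam, coe_vadd]
  rw [← Complex.exp_periodic (2 * π * Complex.I * z / (1 : ℝ))]
  congr 1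
  push_cast
  ring

theorem norm_qParam_lt_one (z : ℍ) : ‖Periodic.qParam 1 (z : ℂ)‖ < 1 :=
  Periodic.norm_qParam_lt_one one_pos z.im_pos

/-- The Euler operator `q d/dq` on power series. -/
noncomputable def eulerOp (A : PowerSeries ℂ) : PowerSeries ℂ := PowerSeries.mk fun m ↦ m * A.coeff m

@[simp] theorem coeff_eulerOp (A : PowerSeries ℂ) (m : ℕ) :
    (eulerOp A).coeff m = m * A.coeff m := by simp [eulerOp]

namespace HasQSeries

variable {f g : ℍ → ℂ} {A B : PowerSeries ℂ}

theorem congr (hf : HasQSeries f A) (h : ∀ z, g z = f z) : HasQSeries g A :=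
  fun z ↦ h z ▸ hf z

theorem add (hf : HasQSeries f A) (hg : HasQSeries g B) :
    HasQSeries (fun z ↦ f z + g z) (A + B) := fun z ↦ by
  simpa [add_mul] using (hf z).add (hg z)

theorem sub (hf : HasQSeries f A) (hg : HasQSeries g B) :
    HasQSeries (fun z ↦ f z - g z) (A - B) := fun z ↦ by
  simpa [sub_mul] using (hf z).sub (hg z)

theorem const_mul (c : ℂ) (hf : HasQSeries f A) :
    HasQSeries (fun z ↦ c * f z) (c • A) := fun z ↦ by
  simpa [mul_assoc] using (hf z).mul_left c

theorem mul (hf : HasQSeries f A) (hg : HasQSeries g B) :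
    HasQSeries (fun z ↦ f z * g z) (A * B) := fun z ↦ by
  have hA := (hf z).summable.norm
  have hB := (hg z).summable.norm
  have hs := (summable_norm_sum_mul_antidiagonal_of_summable_norm hA hB).of_norm
  have ht := tsum_mul_tsum_eq_tsum_sum_antidiagonal_of_summable_norm hA hB
  rw [(hf z).tsum_eq, (hg z).tsum_eq] at ht
  have h := hs.hasSum
  rw [← ht] at h
  refine h.congr_fun fun m ↦ ?_
  rw [PowerSeries.coeff_mul, Finset.sum_mul]
  refine Finset.sum_congr rfl fun p hp ↦ ?_
  rw [← Finset.HasAntidiagonal.mem_antidiagonal.mp hp, pow_add]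
  ring

theorem one : HasQSeries (fun _ ↦ 1) 1 := fun z ↦ by
  refine (hasSum_ite_eq 0 (1 : ℂ)).congr_fun fun m ↦ ?_
  rcases eq_or_ne m 0 with rfl | hm <;> simp [PowerSeries.coeff_one, *]

theorem pow (hf : HasQSeries f A) (k : ℕ) : HasQSeries (fun z ↦ f z ^ k) (A ^ k) := by
  induction k with
  | zero => simpa using one
  | succ k ih => simpa [pow_succ] using ih.mul hf

theorem X : HasQSeries (fun z ↦ Periodic.qParam 1 (z : ℂ)) PowerSeries.X := fun z ↦ by
  refine (hasSum_ite_eq 1 (Periodic.qParam 1 (z : ℂ))).congr_fun fun m ↦ ?_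
  rcases eq_or_ne m 1 with rfl | hm <;> simp [PowerSeries.coeff_X, *]

theorem vadd_one (hf : HasQSeries f A) (z : ℍ) : f ((1 : ℝ) +ᵥ z) = f z := by
  have h := hf ((1 : ℝ) +ᵥ z)
  rw [qParam_vadd] at h
  exact h.unique (hf z)

theorem periodic (hf : HasQSeries f A) : Periodic (f ∘ ofComplex) (1 : ℝ) := by
  intro w
  by_cases hw : 0 < w.im
  · have hw' : 0 < (w + (1 : ℝ)).im := by simpa using hw
    have := hf.vadd_one ⟨w, hw⟩
    simp only [Function.comp_apply, ofComplex_apply_of_im_pos hw, ofComplex_apply_of_im_pos hw']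
    rw [← this]
    congr 1
    ext1
    simp [add_comm]
  · have hw' : (w + (1 : ℝ)).im ≤ 0 := by simpa using hw
    simp only [Function.comp_apply]
    rw [ofComplex_apply_eq_of_im_nonpos hw' (not_lt.mp hw)]

theorem bounded (hf : HasQSeries f A) : IsBoundedAtImInfty f :=
  isBoundedAtImInfty_of_hasSum_qExpansion (h := 1) one_pos (c := fun m ↦ A.coeff m)
    (by simpa [HasQSeries] using hf)

theorem hasComplexDeriv (hf : HasQSeries f A) :
    ∃ f', HasComplexDeriv f (fun z ↦ 2 * π * Complex.I * f' z) ∧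
      HasQSeries f' (eulerOp A) := by
  have key : ∀ z : ℍ, ∃ d, HasDerivAt (f ∘ ofComplex) (2 * π * Complex.I * d) (z : ℂ) ∧
      HasSum (fun m : ℕ ↦ (eulerOp A).coeff m * Periodic.qParam 1 z ^ m) d := by
    intro z
    have hε : 0 < z.im / 2 := by linarith [z.im_pos]
    let U : Set ℂ := {w | z.im / 2 < w.im}
    have hU : IsOpen U := isOpen_lt continuous_const Complex.continuous_im
    have hzU : (z : ℂ) ∈ U := by
      change z.im / 2 < z.im
      linarith [z.im_pos]
    -- Termwise differentiation: |q| decreases with the imaginary part, so the absolutely convergent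
    -- series at `z₀` dominates the series on all of `U`.
    let z₀ : ℍ := ⟨Complex.I * (z.im / 2 : ℝ), by simpa using hε⟩
    have hu := (hf z₀).summable.norm
    let F : ℕ → ℂ → ℂ := fun m w ↦ A.coeff m * Periodic.qParam 1 w ^ m
    have hFd (m : ℕ) (w : ℂ) :
        HasDerivAt (F m) (2 * π * Complex.I * ((eulerOp A).coeff m * Periodic.qParam 1 w ^ m)) w := by
      have h1 : HasDerivAt (fun w : ℂ ↦ Complex.exp (m * (2 * π * Complex.I * w)))
          (Complex.exp (m * (2 * π * Complex.I * w)) * (m * (2 * π * Complex.I * 1))) w :=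
        (((hasDerivAt_id w).const_mul (2 * π * Complex.I)).const_mul (m : ℂ)).cexp
      have h2 (w : ℂ) : Periodic.qParam 1 w ^ m = Complex.exp (m * (2 * π * Complex.I * w)) := by
        rw [Periodic.qParam, ← Complex.exp_nat_mul]
        simp
      have h3 := h1.const_mul (A.coeff m)
      have h4 : F m = fun w ↦ A.coeff m * Complex.exp (m * (2 * π * Complex.I * w)) := by
        funext w
        simp only [F, h2]
      rw [h4]
      refine h3.congr_deriv ?_
      rw [h2, coeff_eulerOp]
      ring
    have hdiff (m : ℕ) : DifferentiableOn ℂ (F m) U :=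
      fun w _ ↦ (hFd m w).differentiableAt.differentiableWithinAt
    have hle (m : ℕ) (w : ℂ) (hw : w ∈ U) :
        ‖F m w‖ ≤ ‖A.coeff m * Periodic.qParam 1 z₀ ^ m‖ := by
      simp only [F, norm_mul, norm_pow]
      gcongr
      rw [Periodic.norm_qParam, Periodic.norm_qParam, Real.exp_le_exp]
      have h₀ : (z₀ : ℂ).im = z.im / 2 := by simp [z₀]
      have hw' : z.im / 2 < w.im := hw
      rw [h₀, div_one, div_one]
      nlinarith [Real.pi_pos]
    have hsum := Complex.hasSum_deriv_of_summable_norm hu hdiff hU hle hzU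
    have hD := (Complex.differentiableOn_tsum_of_summable_norm hu hdiff hU hle).differentiableAt
      (hU.mem_nhds hzU)
    have hEq : f ∘ ofComplex =ᶠ[𝓝 (z : ℂ)] fun w ↦ ∑' m, F m w := by
      filter_upwards [hU.mem_nhds hzU] with w hw
      have hw' : 0 < w.im := hε.trans hw
      simp only [Function.comp_apply, ofComplex_apply_of_im_pos hw']
      exact (hf ⟨w, hw'⟩).tsum_eq.symm
    have hpi : (2 * π * Complex.I : ℂ) ≠ 0 := Complex.two_pi_I_ne_zero
    refine ⟨(2 * π * Complex.I)⁻¹ * deriv (fun w : ℂ ↦ ∑' m, F m w) z, ?_, ?_⟩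
    · rw [mul_inv_cancel_left₀ hpi]
      exact hD.hasDerivAt.congr_of_eventuallyEq hEq
    · refine (hsum.mul_left (2 * π * Complex.I)⁻¹).congr_fun fun m ↦ ?_
      rw [(hFd m z).deriv, inv_mul_cancel_left₀ hpi]
  choose f' h1 h2 using key
  exact ⟨f', h1, h2⟩

theorem mdiff (hf : HasQSeries f A) : MDiff f := by
  obtain ⟨f', h, -⟩ := hf.hasComplexDeriv
  exact h.mdiff

/-- Both series represent the same analytic cusp function near q = 0, so the power series agree.
This is what makes comparison of coefficients legitimate. -/
theorem qExpansion_eq (hf : HasQSeries f A) : qExpansion 1 f = A := by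
  have hd := analyticAt_cuspFunction_zero one_pos hf.periodic hf.mdiff hf.bounded
  have h1 := hasFPowerSeriesOnBall_cuspFunction (c := fun m ↦ A.coeff m) one_pos hd
    (fun z ↦ by simpa only [smul_eq_mul] using hf z)
  have h2 := hasFPowerSeriesOnBall_cuspFunction (c := fun m ↦ (qExpansion 1 f).coeff m) one_pos hd
    (hasSum_qExpansion one_pos hf.periodic hf.mdiff hf.bounded)
  ext m
  simpa using congr_arg (FormalMultilinearSeries.coeff · m)
    (h2.hasFPowerSeriesAt.eq_formalMultilinearSeries h1.hasFPowerSeriesAt)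

theorem unique (hf : HasQSeries f A) (hg : HasQSeries f B) : A = B :=
  hf.qExpansion_eq.symm.trans hg.qExpansion_eq

end HasQSeries

theorem hasQSeries_qExpansion {k : ℤ} {F : Type*} [FunLike F ℍ ℂ] [ModularFormClass F 𝒮ℒ k]
    (f : F) : HasQSeries f (qExpansion 1 f) :=
  fun z ↦ ModularForm.hasSum_qExpansion f one_pos one_mem_strictPeriods_SL z

theorem hasNormalizedExpansion_iff {s : ℂ} {y : ℍ → ℂ} :
    HasNormalizedExpansion s y ↔ ∃ (f : ℍ → ℂ) (A : PowerSeries ℂ),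
      HasQSeries f A ∧ A.coeff 0 = 1 ∧ ∀ z, y z = qPow s z * f z := by
  constructor
  · rintro ⟨a, h0, h⟩
    refine ⟨fun z ↦ (qPow s z)⁻¹ * y z, PowerSeries.mk a, fun z ↦ ?_, by simpa using h0,
      fun z ↦ (mul_inv_cancel_left₀ (qPow_ne_zero s z) _).symm⟩
    refine ((h z).mul_left (qPow s z)⁻¹).congr_fun fun m ↦ ?_
    rw [qPow_add, qPow_natCast, PowerSeries.coeff_mk]
    field_simp [qPow_ne_zero s z]
  · rintro ⟨f, A, hf, h0, h⟩
    refine ⟨fun m ↦ A.coeff m, h0, fun z ↦ ?_⟩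
    rw [h z]
    refine ((hf z).mul_left (qPow s z)).congr_fun fun m ↦ ?_
    rw [qPow_add, qPow_natCast]
    ring

theorem HasQSeries.hasComplexDeriv_qPow_mul {f : ℍ → ℂ} {A : PowerSeries ℂ} (s : ℂ)
    (hf : HasQSeries f A) : ∃ f', HasQSeries f' (s • A + eulerOp A) ∧
      HasComplexDeriv (fun z ↦ qPow s z * f z)
        (fun z ↦ 2 * π * Complex.I * (qPow s z * f' z)) := by
  obtain ⟨f', hd, hq⟩ := hf.hasComplexDeriv
  refine ⟨_, (hf.const_mul s).add hq, ?_⟩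
  convert (hasComplexDeriv_qPow s).mul hd using 2 with z
  ring

/-! ### The Frobenius method at the cusp. -/

/-- The `q`-expansion of `E₄`. -/
noncomputable def seriesE₄ : PowerSeries ℂ := qExpansion 1 E₄

theorem hasQSeries_E₄ : HasQSeries E₄ seriesE₄ := hasQSeries_qExpansion E₄

theorem coeff_zero_seriesE₄ : seriesE₄.coeff 0 = 1 :=
  EisensteinSeries.E_qExpansion_coeff_zero _ ⟨2, rfl⟩

/-- On q^s times a `q`-series, d/dz is 2πi times s plus the Euler operator. Dividing Q by (2πi)²
leaves the factor n²/16. -/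
theorem isSolution_potential_iff {n : ℕ} {s : ℂ} {f y : ℍ → ℂ} {A : PowerSeries ℂ}
    (hf : HasQSeries f A) (hy : ∀ z, y z = qPow s z * f z) :
    IsSolution (potential n) y ↔
      ∀ m : ℕ, (s + m) ^ 2 * A.coeff m = (n : ℂ) ^ 2 / 16 * (A * seriesE₄).coeff m := by
  obtain rfl : y = fun z ↦ qPow s z * f z := funext hy
  obtain ⟨f₁, hf₁, hd₁⟩ := hf.hasComplexDeriv_qPow_mul s
  obtain ⟨f₂, hf₂, hd₂⟩ := hf₁.hasComplexDeriv_qPow_mul s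
  have hd₂' := hd₂.const_mul (2 * π * Complex.I)
  have hE := (hf.mul hasQSeries_E₄).const_mul ((n : ℂ) ^ 2 / 16)
  have hpi : (π : ℂ) ≠ 0 := mod_cast Real.pi_ne_zero
  have hIsq : (Complex.I : ℂ) ^ 2 = -1 := Complex.I_sq
  have hval (z : ℍ) : 2 * π * Complex.I * (2 * π * Complex.I * (qPow s z * f₂ z)) =
      potential n z * (qPow s z * f z) ↔ f₂ z = (n : ℂ) ^ 2 / 16 * (f z * E₄ z) := by
    have hne : -4 * (π : ℂ) ^ 2 * qPow s z ≠ 0 := by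
      simp [hpi, qPow_ne_zero]
    rw [← mul_right_inj' hne (b := f₂ z), potential]
    refine Eq.congr ?_ ?_
    · linear_combination 4 * π ^ 2 * qPow s z * f₂ z * hIsq
    · ring
  have hco (m : ℕ) : (s • (s • A + eulerOp A) + eulerOp (s • A + eulerOp A)).coeff m =
      (s + m) ^ 2 * A.coeff m := by
    simp
    ring
  rw [isSolution_iff]
  constructor
  · rintro ⟨y', h1, h2⟩ m
    obtain rfl := h1.unique hd₁
    have h3 := h2.unique hd₂'
    have h4 (z : ℍ) : (n : ℂ) ^ 2 / 16 * (f z * E₄ z) = f₂ z :=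
      ((hval z).mp (congrFun h3 z).symm).symm
    rw [← hco, hf₂.unique (hE.congr fun z ↦ (h4 z).symm)]
    simp
  · intro h
    refine ⟨_, hd₁, ?_⟩
    have hser : s • (s • A + eulerOp A) + eulerOp (s • A + eulerOp A) =
        ((n : ℂ) ^ 2 / 16) • (A * seriesE₄) := by
      ext m
      rw [hco, h m]
      simp
    have h5 (z : ℍ) : f₂ z = (n : ℂ) ^ 2 / 16 * (f z * E₄ z) := by
      have := hf₂ z
      rw [hser] at this
      exact this.unique (hE z)
    convert hd₂' using 2 with z
    exact ((hval z).mpr (h5 z)).symm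

theorem coeff_mul_seriesE₄ (A : PowerSeries ℂ) (m : ℕ) : (A * seriesE₄).coeff m =
    ∑ k ∈ Finset.range m, A.coeff k * seriesE₄.coeff (m - k) + A.coeff m := by
  rw [PowerSeries.coeff_mul, Finset.Nat.sum_antidiagonal_eq_sum_range_succ
    (fun i j ↦ A.coeff i * seriesE₄.coeff j), Finset.sum_range_succ]
  simp [coeff_zero_seriesE₄]

/-- The constant term of E₄ is 1, so the term of index m moves to the left side, where (s + m)² - s²
= m(m + 2s). -/
theorem recursion_iff {n : ℕ} {s : ℂ} (hs : s ^ 2 = (n : ℂ) ^ 2 / 16) (A : PowerSeries ℂ) (m : ℕ) :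
    (s + m) ^ 2 * A.coeff m = (n : ℂ) ^ 2 / 16 * (A * seriesE₄).coeff m ↔
      m * (m + 2 * s) * A.coeff m =
        s ^ 2 * ∑ k ∈ Finset.range m, A.coeff k * seriesE₄.coeff (m - k) := by
  rw [coeff_mul_seriesE₄, ← hs]
  constructor <;> intro h <;> linear_combination h

/-- The subfield of rational numbers in `ℂ`. -/
noncomputable abbrev ratField : Subfield ℂ := (algebraMap ℚ ℂ).fieldRange

theorem coeff_seriesE₄_mem (m : ℕ) : seriesE₄.coeff m ∈ ratField := by
  rw [seriesE₄, EisensteinSeries.E_qExpansion_coeff _ ⟨2, rfl⟩]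
  split_ifs
  · exact one_mem _
  · refine mul_mem (neg_mem (div_mem (mul_mem (ofNat_mem _ _) (natCast_mem _ _)) ?_))
      (natCast_mem _ _)
    exact ⟨bernoulli 4, by simp⟩

theorem coeff_mem_of_recursion {s : ℂ} (hs : s ∈ ratField) (hne : ∀ m : ℕ, m + 2 * s ≠ 0)
    {A : PowerSeries ℂ} (h0 : A.coeff 0 = 1)
    (h : ∀ m : ℕ, m * (m + 2 * s) * A.coeff m =
        s ^ 2 * ∑ k ∈ Finset.range m, A.coeff k * seriesE₄.coeff (m - k)) (m : ℕ) :
    A.coeff m ∈ ratField := by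
  induction m using Nat.strong_induction_on with
  | _ m ih =>
    rcases eq_or_ne m 0 with rfl | hm
    · rw [h0]
      exact one_mem _
    · have hm' : (m : ℂ) * (m + 2 * s) ≠ 0 := mul_ne_zero (mod_cast hm) (hne m)
      rw [eq_div_of_mul_eq hm' ((mul_comm _ _).trans (h m))]
      refine div_mem (mul_mem (pow_mem hs 2) (sum_mem fun k hk ↦ ?_))
        (mul_mem (natCast_mem _ _) (add_mem (natCast_mem _ _) (mul_mem (ofNat_mem _ _) hs)))
      exact mul_mem (ih k (Finset.mem_range.mp hk)) (coeff_seriesE₄_mem _)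

/-- The coefficients of the Frobenius solution with exponent `s`. -/
noncomputable def frobeniusCoeff (s : ℂ) : ℕ → ℂ
  | 0 => 1
  | m + 1 => s ^ 2 * (∑ i : Fin (m + 1), frobeniusCoeff s i * seriesE₄.coeff (m + 1 - i)) /
      ((m + 1 : ℕ) * ((m + 1 : ℕ) + 2 * s))

theorem frobeniusCoeff_recursion {s : ℂ} (hne : ∀ m : ℕ, m + 2 * s ≠ 0) (m : ℕ) :
    m * (m + 2 * s) * frobeniusCoeff s m =
      s ^ 2 * ∑ k ∈ Finset.range m, frobeniusCoeff s k * seriesE₄.coeff (m - k) := by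
  cases m with
  | zero => simp
  | succ m =>
    have hm' : ((m + 1 : ℕ) : ℂ) * ((m + 1 : ℕ) + 2 * s) ≠ 0 :=
      mul_ne_zero (mod_cast m.succ_ne_zero) (hne _)
    rw [frobeniusCoeff, mul_div_cancel₀ _ hm',
      Fin.sum_univ_eq_sum_range (fun i ↦ frobeniusCoeff s i * seriesE₄.coeff (m + 1 - i))]

/-- Sequences bounded by a convolution with a summable sequence, divided by the index, are
bounded. -/
theorem bounded_of_convolution_le {b e : ℕ → ℝ} {C : ℝ} (hb : ∀ m, 0 ≤ b m) (he : ∀ m, 0 ≤ e m)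
    (hC : 0 ≤ C) (hsum : Summable e)
    (h : ∀ m : ℕ, m * b m ≤ C * ∑ k ∈ Finset.range m, b k * e (m - k)) :
    ∃ M, ∀ m, b m ≤ M := by
  -- Beyond N the division by m absorbs `C * ∑' k, e k`, so a bound for the indices up to N
  -- propagates by strong induction.
  obtain ⟨N, hN⟩ := exists_nat_ge (C * ∑' k, e k)
  refine ⟨∑ j ∈ Finset.range (N + 1), b j, fun m ↦ ?_⟩
  have hM : 0 ≤ ∑ j ∈ Finset.range (N + 1), b j := Finset.sum_nonneg fun j _ ↦ hb j
  induction m using Nat.strong_induction_on with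
  | _ m ih =>
    rcases Nat.lt_or_ge m (N + 1) with hm | hm
    · exact Finset.single_le_sum (fun j _ ↦ hb j) (Finset.mem_range.mpr hm)
    · have hm0 : (0 : ℝ) < m := by exact_mod_cast (Nat.succ_pos N).trans_le hm
      set M := ∑ j ∈ Finset.range (N + 1), b j
      have h1 : ∑ k ∈ Finset.range m, b k * e (m - k) ≤ M * ∑' k, e k := by
        calc ∑ k ∈ Finset.range m, b k * e (m - k)
            ≤ ∑ k ∈ Finset.range m, M * e (m - k) :=
              Finset.sum_le_sum fun k hk ↦
                mul_le_mul_of_nonneg_right (ih k (Finset.mem_range.mp hk)) (he _)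
          _ = M * ∑ k ∈ Finset.range m, e (m - k) := by rw [Finset.mul_sum]
          _ ≤ M * ∑ k ∈ Finset.range (m + 1), e (m - k) := by
              gcongr
              · exact fun _ _ _ ↦ he _
              · exact Nat.le_succ m
          _ = M * ∑ k ∈ Finset.range (m + 1), e k := by
              rw [← Finset.sum_range_reflect e (m + 1)]
              simp
          _ ≤ M * ∑' k, e k := by
              gcongr
              exact hsum.sum_le_tsum _ fun _ _ ↦ he _
      have h2 : (m : ℝ) * b m ≤ m * M := by
        calc (m : ℝ) * b m ≤ C * (M * ∑' k, e k) := (h m).trans (by gcongr)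
          _ = (C * ∑' k, e k) * M := by ring
          _ ≤ N * M := by gcongr
          _ ≤ m * M := by
              gcongr
              exact (Nat.le_succ N).trans hm
      exact le_of_mul_le_mul_left h2 hm0

theorem summable_of_hasQSeries {f : ℍ → ℂ} {A : PowerSeries ℂ} (hf : HasQSeries f A) {r : ℝ}
    (hr0 : 0 < r) (hr1 : r < 1) : Summable fun m ↦ ‖A.coeff m‖ * r ^ m := by
  have h1 : 0 < (Complex.I * (-Real.log r / (2 * π) : ℝ)).im := by
    rw [Complex.I_mul_im, Complex.ofReal_re]
    exact div_pos (neg_pos.mpr (Real.log_neg hr0 hr1)) (by positivity)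
  have h := (hf ⟨_, h1⟩).summable.norm
  refine h.congr fun m ↦ ?_
  rw [norm_mul, norm_pow, Periodic.norm_qParam]
  congr 2
  rw [Complex.I_mul_im, Complex.ofReal_re]
  have : -2 * π * (-Real.log r / (2 * π)) / 1 = Real.log r := by
    field_simp
  rw [this, Real.exp_log hr0]

theorem ne_zero_of_half_le_norm {x : ℂ} (h : 1 / 2 ≤ ‖x‖) : x ≠ 0 := by
  rintro rfl
  norm_num at h

theorem summable_frobeniusCoeff {s : ℂ} (hne : ∀ m : ℕ, 1 / 2 ≤ ‖m + 2 * s‖) {r : ℝ}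
    (hr0 : 0 ≤ r) (hr1 : r < 1) : Summable fun m ↦ ‖frobeniusCoeff s m‖ * r ^ m := by
  -- Boundedness of the terms at the larger radius ρ gives geometric decay at r. The constant 2‖s‖²
  -- below comes from ‖m + 2s‖ ≥ 1/2.
  obtain ⟨ρ, hrρ, hρ1⟩ := exists_between hr1
  have hρ0 : 0 < ρ := hr0.trans_lt hrρ
  have hne' (m : ℕ) : (m : ℂ) + 2 * s ≠ 0 := ne_zero_of_half_le_norm (hne m)
  obtain ⟨M, hM⟩ := bounded_of_convolution_le (b := fun m ↦ ‖frobeniusCoeff s m‖ * ρ ^ m)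
    (e := fun m ↦ ‖seriesE₄.coeff m‖ * ρ ^ m) (C := 2 * ‖s‖ ^ 2) (fun m ↦ by positivity)
    (fun m ↦ by positivity) (by positivity) (summable_of_hasQSeries hasQSeries_E₄ hρ0 hρ1) (by
      intro m
      have h1 := congrArg norm (frobeniusCoeff_recursion hne' m)
      rw [norm_mul, norm_mul, norm_mul, norm_pow, Complex.norm_natCast] at h1
      have h2 : ‖∑ k ∈ Finset.range m, frobeniusCoeff s k * seriesE₄.coeff (m - k)‖ * ρ ^ m ≤
          ∑ k ∈ Finset.range m, ‖frobeniusCoeff s k‖ * ρ ^ k *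
            (‖seriesE₄.coeff (m - k)‖ * ρ ^ (m - k)) := by
        refine (mul_le_mul_of_nonneg_right (norm_sum_le _ _) (by positivity)).trans_eq ?_
        rw [Finset.sum_mul]
        refine Finset.sum_congr rfl fun k hk ↦ ?_
        rw [norm_mul]
        rw [show ρ ^ m = ρ ^ k * ρ ^ (m - k) by
          rw [← pow_add, Nat.add_sub_cancel' (Finset.mem_range.mp hk).le]]
        ring
      have h3 : (m : ℝ) * (1 / 2) * (‖frobeniusCoeff s m‖ * ρ ^ m) ≤
          m * ‖m + 2 * s‖ * (‖frobeniusCoeff s m‖ * ρ ^ m) := by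
        gcongr
        exact hne m
      have h4 : m * ‖m + 2 * s‖ * (‖frobeniusCoeff s m‖ * ρ ^ m) = ‖s‖ ^ 2 *
          (‖∑ k ∈ Finset.range m, frobeniusCoeff s k * seriesE₄.coeff (m - k)‖ * ρ ^ m) := by
        rw [← mul_assoc, h1, mul_assoc]
      have h5 := mul_le_mul_of_nonneg_left h2 (by positivity : 0 ≤ ‖s‖ ^ 2)
      linarith)
  refine Summable.of_nonneg_of_le (fun m ↦ by positivity) (fun m ↦ ?_)
    ((summable_geometric_of_lt_one (div_nonneg hr0 hρ0.le) ((div_lt_one hρ0).mpr hrρ)).mul_left M)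
  calc ‖frobeniusCoeff s m‖ * r ^ m = ‖frobeniusCoeff s m‖ * ρ ^ m * (r / ρ) ^ m := by
        rw [div_pow]
        field_simp
    _ ≤ M * (r / ρ) ^ m := by
        gcongr
        exact hM m

theorem exists_solution {n : ℕ} {s : ℂ} (hs : s ^ 2 = (n : ℂ) ^ 2 / 16)
    (hne : ∀ m : ℕ, 1 / 2 ≤ ‖m + 2 * s‖) :
    ∃ y, IsSolution (potential n) y ∧ HasNormalizedExpansion s y := by
  have hne' (m : ℕ) : (m : ℂ) + 2 * s ≠ 0 := ne_zero_of_half_le_norm (hne m)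
  have hq : HasQSeries (fun z ↦ ∑' m, frobeniusCoeff s m * Periodic.qParam 1 (z : ℂ) ^ m)
      (PowerSeries.mk (frobeniusCoeff s)) := by
    intro z
    simp only [PowerSeries.coeff_mk]
    refine (Summable.of_norm ?_).hasSum
    simpa using summable_frobeniusCoeff hne (norm_nonneg (Periodic.qParam 1 (z : ℂ)))
      (norm_qParam_lt_one z)
  refine ⟨fun z ↦ qPow s z * _, (isSolution_potential_iff hq fun z ↦ rfl).mpr fun m ↦ ?_,
    hasNormalizedExpansion_iff.mpr ⟨_, _, hq, by simp [frobeniusCoeff], fun z ↦ rfl⟩⟩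
  rw [recursion_iff hs]
  simpa using frobeniusCoeff_recursion hne' m

/-- Twice m + 2s is 2m ∓ n, an odd integer: the absence of resonance. -/
theorem half_le_norm_add {n : ℕ} (hn : Odd n) {s : ℂ} (hs : s = -(n : ℂ) / 4 ∨ s = (n : ℂ) / 4)
    (m : ℕ) : 1 / 2 ≤ ‖m + 2 * s‖ := by
  have key (k : ℤ) (hk : Odd k) : 1 / 2 ≤ ‖(k : ℂ) / 2‖ := by
    rw [norm_div, Complex.norm_intCast, Complex.norm_ofNat]
    have : (1 : ℝ) ≤ |(k : ℝ)| := by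
      exact_mod_cast Int.one_le_abs (fun h ↦ by simp [h] at hk)
    linarith
  have hn' : Odd (n : ℤ) := by exact_mod_cast hn
  rcases hs with rfl | rfl
  · convert key (2 * m - n) ((even_two_mul (m : ℤ)).sub_odd hn') using 2
    push_cast
    ring
  · convert key (2 * m + n) ((even_two_mul (m : ℤ)).add_odd hn') using 2
    push_cast
    ring

/-- The coefficients of a normalized solution are rational. -/
theorem IsSolution.exists_rational_series {n : ℕ} (hn : Odd n) {s : ℂ}
    (hs : s = -(n : ℂ) / 4 ∨ s = (n : ℂ) / 4) {y : ℍ → ℂ} (hy : IsSolution (potential n) y)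
    (he : HasNormalizedExpansion s y) : ∃ (f : ℍ → ℂ) (A : PowerSeries ℂ),
      HasQSeries f A ∧ A.coeff 0 = 1 ∧ (∀ z, y z = qPow s z * f z) ∧
        ∀ m, A.coeff m ∈ ratField := by
  obtain ⟨f, A, hf, h0, h⟩ := hasNormalizedExpansion_iff.mp he
  refine ⟨f, A, hf, h0, h, coeff_mem_of_recursion (s := s) ?_
    (fun m ↦ ne_zero_of_half_le_norm (half_le_norm_add hn hs m)) h0 fun m ↦ ?_⟩
  · rcases hs with rfl | rfl
    · exact div_mem (neg_mem (natCast_mem _ _)) (ofNat_mem _ _)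
    · exact div_mem (natCast_mem _ _) (ofNat_mem _ _)
  · rw [← recursion_iff (n := n) (by rcases hs with rfl | rfl <;> ring)]
    exact (isSolution_potential_iff hf h).mp hy m

/-! ### The Wronskian and the action of the inversion on solutions. -/

/-- The Wronskian of two solutions is constant. -/
theorem exists_wronskian {Q y u y' u' : ℍ → ℂ} (hy : HasComplexDeriv y y')
    (hy' : HasComplexDeriv y' fun z ↦ Q z * y z) (hu : HasComplexDeriv u u')
    (hu' : HasComplexDeriv u' fun z ↦ Q z * u z) :
    ∃ w, ∀ z, y z * u' z - y' z * u z = w := by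
  apply HasComplexDeriv.eq_const
  convert (hy.mul hu').sub (hy'.mul hu) using 1
  funext z
  simp only [Pi.zero_apply]
  ring

/-- The image `z ↦ z y(-1/z)` of `y` under the inversion. -/
noncomputable def invSlash (y : ℍ → ℂ) (z : ℍ) : ℂ := z * y (ModularGroup.S • z)

theorem coe_S_smul (z : ℍ) : ((ModularGroup.S • z : ℍ) : ℂ) = -(z : ℂ)⁻¹ := by
  rw [modular_S_smul]
  simp [inv_neg]

theorem S_smul_S_smul (z : ℍ) : ModularGroup.S • ModularGroup.S • z = z := by
  ext1
  rw [coe_S_smul, coe_S_smul, inv_neg, inv_inv, neg_neg]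

/-- The sign is z · (-1/z): the matrix of `S` squares to -1 and the weight is odd. -/
theorem invSlash_invSlash (y : ℍ → ℂ) (z : ℍ) : invSlash (invSlash y) z = -y z := by
  rw [invSlash, invSlash, S_smul_S_smul, coe_S_smul]
  field_simp [z.ne_zero]

theorem HasComplexDeriv.comp_S {f f' : ℍ → ℂ} (hf : HasComplexDeriv f f') :
    HasComplexDeriv (fun z ↦ f (ModularGroup.S • z))
      fun z ↦ f' (ModularGroup.S • z) * ((z : ℂ) ^ 2)⁻¹ := by
  intro z
  have hinv : HasDerivAt (fun w : ℂ ↦ -w⁻¹) (((z : ℂ) ^ 2)⁻¹) z := by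
    simpa only [neg_neg] using (hasDerivAt_inv z.ne_zero).fun_neg
  have hfS := hf (ModularGroup.S • z)
  rw [coe_S_smul] at hfS
  refine (hfS.comp (z : ℂ) hinv).congr_of_eventuallyEq ?_
  filter_upwards [isOpen_upperHalfPlaneSet.mem_nhds z.2] with w hw
  simp only [Function.comp_apply, ofComplex_apply_of_im_pos hw]
  have h := coe_S_smul ⟨w, hw⟩
  rw [coe_mk] at h
  rw [← h, ofComplex_apply]

theorem hasComplexDeriv_coe : HasComplexDeriv (fun z ↦ (z : ℂ)) fun _ ↦ 1 := by
  intro z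
  refine (hasDerivAt_id (z : ℂ)).congr_of_eventuallyEq ?_
  filter_upwards [isOpen_upperHalfPlaneSet.mem_nhds z.2] with w hw
  simp [ofComplex_apply_of_im_pos hw]

theorem hasComplexDeriv_inv : HasComplexDeriv (fun z ↦ (z : ℂ)⁻¹) fun z ↦ -((z : ℂ) ^ 2)⁻¹ := by
  intro z
  refine (hasDerivAt_inv z.ne_zero).congr_of_eventuallyEq ?_
  filter_upwards [isOpen_upperHalfPlaneSet.mem_nhds z.2] with w hw
  simp [ofComplex_apply_of_im_pos hw]

/-- If `Q` has weight `4`, then `z ↦ z y(-1/z)` solves `y'' = Q y` whenever `y` does. -/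
theorem IsSolution.invSlash {Q y : ℍ → ℂ} (hQ : ∀ z : ℍ, Q (ModularGroup.S • z) = z ^ 4 * Q z)
    (hy : IsSolution Q y) : IsSolution Q (invSlash y) := by
  obtain ⟨y', h1, h2⟩ := isSolution_iff.mp hy
  refine isSolution_iff.mpr ⟨fun z ↦ y (ModularGroup.S • z) + (z : ℂ)⁻¹ * y' (ModularGroup.S • z),
    ?_, ?_⟩
  · refine fun z ↦ ((hasComplexDeriv_coe.mul h1.comp_S) z).congr_deriv ?_
    field_simp [z.ne_zero]
  · convert h1.comp_S.add (hasComplexDeriv_inv.mul h2.comp_S) using 2 with z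
    rw [hQ, ModularODE.invSlash]
    field_simp [z.ne_zero]
    ring

theorem slash_S_apply (f : ℍ → ℂ) (k : ℤ) (z : ℍ) :
    (f ∣[k] ModularGroup.S) z = f (ModularGroup.S • z) * (z : ℂ) ^ (-k) := by
  rw [SL_slash_apply, ModularGroup.denom_S]

theorem slash_T_apply (f : ℍ → ℂ) (k : ℤ) (z : ℍ) :
    (f ∣[k] ModularGroup.T) z = f ((1 : ℝ) +ᵥ z) := by
  rw [SL_slash_apply, modular_T_smul]
  have h : denom (ModularGroup.T : GL (Fin 2) ℝ) z = 1 := by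
    rw [ModularGroup.denom_apply, ModularGroup.coe_T]
    simp
  rw [h, one_zpow, mul_one]

theorem E₄_S_smul (z : ℍ) : E₄ (ModularGroup.S • z) = z ^ 4 * E₄ z := by
  have h := congrFun (E₄.slash_action_eq' _ ⟨ModularGroup.S, rfl⟩) z
  change ((E₄ : ℍ → ℂ) ∣[(4 : ℤ)] ModularGroup.S) z = E₄ z at h
  rw [slash_S_apply] at h
  rw [← h]
  field_simp [z.ne_zero]

theorem potential_S_smul (n : ℕ) (z : ℍ) :
    potential n (ModularGroup.S • z) = z ^ 4 * potential n z := by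
  rw [potential, potential, E₄_S_smul]
  ring

/-- The level one modular form given by a bounded holomorphic function invariant under `S` and
`T`. -/
def modularFormOfGenerators {k : ℤ} (f : ℍ → ℂ) (hS : f ∣[k] ModularGroup.S = f)
    (hT : f ∣[k] ModularGroup.T = f) (hol : MDiff f) (hb : IsBoundedAtImInfty f) :
    ModularForm 𝒮ℒ k where
  toFun := f
  slash_action_eq' A hA := by
    obtain ⟨A, rfl⟩ := hA
    exact SlashInvariantForm.slash_action_generators_SL2Z hS hT A
  holo' := hol
  bdd_at_cusps' hc := by
    rw [Subgroup.IsArithmetic.isCusp_iff_isCusp_SL2Z] at hc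
    rw [OnePoint.isBoundedAt_iff_forall_SL2Z hc]
    intro γ _
    rw [SlashInvariantForm.slash_action_generators_SL2Z hS hT]
    exact hb

/-! ### The solution basis and the anti-invariant square sum. -/

/-- A pair of normalized solutions with exponents `∓ n / 4`. -/
structure IsBasis (n : ℕ) (y u : ℍ → ℂ) : Prop where
  sol_left : IsSolution (potential n) y
  exp_left : HasNormalizedExpansion (-(n : ℂ) / 4) y
  sol_right : IsSolution (potential n) u
  exp_right : HasNormalizedExpansion ((n : ℂ) / 4) u

namespace IsBasis

variable {n : ℕ} {y u : ℍ → ℂ}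

theorem exists_wronskian_ne_zero (hn : Odd n) (h : IsBasis n y u) : ∃ y' u' : ℍ → ℂ, ∃ w ≠ 0,
    HasComplexDeriv y y' ∧ HasComplexDeriv y' (fun z ↦ potential n z * y z) ∧
    HasComplexDeriv u u' ∧ HasComplexDeriv u' (fun z ↦ potential n z * u z) ∧
    ∀ z, y z * u' z - y' z * u z = w := by
  obtain ⟨y', hy1, hy2⟩ := isSolution_iff.mp h.sol_left
  obtain ⟨u', hu1, hu2⟩ := isSolution_iff.mp h.sol_right
  obtain ⟨w, hw⟩ := exists_wronskian hy1 hy2 hu1 hu2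
  refine ⟨y', u', w, ?_, hy1, hy2, hu1, hu2, hw⟩
  obtain ⟨f, A, hf, hA, hyf⟩ := hasNormalizedExpansion_iff.mp h.exp_left
  obtain ⟨g, B, hg, hB, hug⟩ := hasNormalizedExpansion_iff.mp h.exp_right
  obtain rfl : y = _ := funext hyf
  obtain rfl : u = _ := funext hug
  obtain ⟨f₁, hf₁, hdf⟩ := hf.hasComplexDeriv_qPow_mul (-(n : ℂ) / 4)
  obtain ⟨g₁, hg₁, hdg⟩ := hg.hasComplexDeriv_qPow_mul ((n : ℂ) / 4)
  obtain rfl := hy1.unique hdf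
  obtain rfl := hu1.unique hdg
  have hser := ((hf.mul hg₁).sub (hf₁.mul hg)).const_mul (2 * π * Complex.I)
  have hconst := HasQSeries.one.const_mul w
  have hq (z : ℍ) : qPow (-(n : ℂ) / 4) z * qPow ((n : ℂ) / 4) z = 1 := by
    rw [← qPow_add, neg_div, neg_add_cancel, qPow_zero]
  have heq := hser.unique (hconst.congr fun z ↦ by
    rw [← hw z]
    linear_combination (-(2 * π * Complex.I * (f z * g₁ z - f₁ z * g z))) * hq z)
  -- The exponents cancel in the Wronskian, whose constant term is 2πi (n/4 + n/4).
  have h0 := congrArg (PowerSeries.coeff 0) heq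
  simp [PowerSeries.coeff_zero_eq_constantCoeff] at h0 hA hB
  simp [hA, hB] at h0
  have he (C : PowerSeries ℂ) : PowerSeries.constantCoeff (eulerOp C) = 0 := by
    rw [← PowerSeries.coeff_zero_eq_constantCoeff_apply, coeff_eulerOp, Nat.cast_zero, zero_mul]
  rw [he, he] at h0
  rintro rfl
  have hn0 : (n : ℂ) ≠ 0 := by
    rintro h
    simp [Nat.cast_eq_zero.mp h] at hn
  have hpi : (π : ℂ) ≠ 0 := mod_cast Real.pi_ne_zero
  have : (2 * π * Complex.I) * ((n : ℂ) / 2) ≠ 0 := by simp [hn0, hpi]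
  apply this
  linear_combination h0

/-- Cramer's rule, with constant Wronskians as the determinants. -/
theorem exists_eq_combination (hn : Odd n) (h : IsBasis n y u) {v : ℍ → ℂ}
    (hv : IsSolution (potential n) v) : ∃ a b : ℂ, ∀ z, v z = a * y z + b * u z := by
  obtain ⟨y', u', w, hw0, hy1, hy2, hu1, hu2, hw⟩ := h.exists_wronskian_ne_zero hn
  obtain ⟨v', hv1, hv2⟩ := isSolution_iff.mp hv
  obtain ⟨w₁, hw₁⟩ := exists_wronskian hv1 hv2 hu1 hu2
  obtain ⟨w₂, hw₂⟩ := exists_wronskian hy1 hy2 hv1 hv2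
  refine ⟨w₁ / w, w₂ / w, fun z ↦ ?_⟩
  field_simp
  linear_combination (-v z) * hw z + y z * hw₁ z + u z * hw₂ z

theorem eq_zero_of_combination (hn : Odd n) (h : IsBasis n y u) {a b : ℂ}
    (hab : ∀ z, a * y z + b * u z = 0) : a = 0 ∧ b = 0 := by
  obtain ⟨y', u', w, hw0, hy1, hy2, hu1, hu2, hw⟩ := h.exists_wronskian_ne_zero hn
  have hd : HasComplexDeriv (fun _ ↦ 0) fun z ↦ a * y' z + b * u' z := by
    have := (hy1.const_mul a).add (hu1.const_mul b)
    simpa only [hab] using this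
  have h0 : HasComplexDeriv (fun _ ↦ 0) fun _ ↦ 0 := fun z ↦ hasDerivAt_const _ _
  have h1 (z : ℍ) : a * y' z + b * u' z = 0 := congrFun (hd.unique h0) z
  constructor
  · refine (mul_eq_zero.mp ?_).resolve_right hw0
    linear_combination (-a) * hw I + u' I * hab I - u I * h1 I
  · refine (mul_eq_zero.mp ?_).resolve_right hw0
    linear_combination (-b) * hw I + y I * h1 I - y' I * hab I

/-- The solution of larger exponent is not an eigenvector of the inversion. -/
theorem not_invSlash_eq_mul (hn : Odd n) (h : IsBasis n y u) {d : ℂ} (hd : d ^ 2 = -1) :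
    ¬ ∀ z, invSlash u z = d * u z := by
  intro hS
  obtain ⟨g, B, hg, hB, hug⟩ := hasNormalizedExpansion_iff.mp h.exp_right
  -- The fourth power makes the exponent n/4 integral and the eigenvalue 1, as d⁴ = 1. The result is
  -- a level one form of negative weight, hence zero.
  have hser : HasQSeries (fun z ↦ u z ^ 4) (PowerSeries.X ^ n * B ^ 4) := by
    refine ((HasQSeries.X.pow n).mul (hg.pow 4)).congr fun z ↦ ?_
    rw [hug, mul_pow, qPow_pow, ← qPow_natCast]
    congr 2
    push_cast
    ring
  have hfS : (fun z ↦ u z ^ 4) ∣[(-4 : ℤ)] ModularGroup.S = fun z ↦ u z ^ 4 := by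
    funext z
    rw [slash_S_apply]
    have h1 := congrArg (· ^ 4) (hS z)
    simp only [invSlash] at h1
    rw [mul_pow, mul_pow, show d ^ 4 = (d ^ 2) ^ 2 by ring, hd] at h1
    rw [neg_neg, show (z : ℂ) ^ (4 : ℤ) = (z : ℂ) ^ 4 from zpow_natCast _ 4]
    linear_combination h1
  have hfT : (fun z ↦ u z ^ 4) ∣[(-4 : ℤ)] ModularGroup.T = fun z ↦ u z ^ 4 := by
    funext z
    rw [slash_T_apply]
    exact hser.vadd_one z
  have h0 := ModularFormClass.levelOne_neg_weight_eq_zero (by norm_num)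
    (modularFormOfGenerators _ hfS hfT hser.mdiff hser.bounded)
  have h0' (z : ℍ) : u z = 0 := pow_eq_zero_iff (n := 4) (by norm_num) |>.mp (congrFun h0 z)
  exact one_ne_zero (h.eq_zero_of_combination hn (a := 0) (b := 1) (by simp [h0'])).2

/-- The square sum on which the inversion acts by `-1`. -/
theorem exists_square_sum (hn : Odd n) (h : IsBasis n y u) : ∃ c : ℂ, ∀ z : ℍ,
    (z : ℂ) ^ 2 * (y (ModularGroup.S • z) ^ 2 + c * u (ModularGroup.S • z) ^ 2) =
      -(y z ^ 2 + c * u z ^ 2) := by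
  obtain ⟨a, b, hy⟩ := h.exists_eq_combination hn (h.sol_left.invSlash (potential_S_smul n))
  obtain ⟨c, d, hu⟩ := h.exists_eq_combination hn (h.sol_right.invSlash (potential_S_smul n))
  have hSS {v : ℍ → ℂ} {p r : ℂ} (hv : ∀ z, invSlash v z = p * y z + r * u z) (z : ℍ) :
      p * (a * y z + b * u z) + r * (c * y z + d * u z) = -v z := by
    rw [← hy, ← hu, ← invSlash_invSlash v z]
    nth_rewrite 3 [invSlash]
    rw [hv, invSlash, invSlash]
    ring
  -- Entries of the matrix identity (a, b; c, d)² = -1.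
  obtain ⟨h1, h2⟩ := h.eq_zero_of_combination hn (a := a ^ 2 + b * c + 1) (b := b * (a + d))
    fun z ↦ by linear_combination hSS hy z
  obtain ⟨h3, h4⟩ := h.eq_zero_of_combination hn (a := c * (a + d)) (b := b * c + d ^ 2 + 1)
    fun z ↦ by linear_combination hSS hu z
  have hc : c ≠ 0 := by
    rintro rfl
    exact h.not_invSlash_eq_mul hn (d := d) (by linear_combination h4) fun z ↦ by simp [hu]
  have had : d = -a := by
    linear_combination (mul_eq_zero.mp h3).resolve_left hc
  subst had
  -- The ratio b/c makes the cross terms 2ab·yu and -2ab·yu cancel; a² + bc = -1 then supplies the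
  -- sign.
  refine ⟨b / c, fun z ↦ ?_⟩
  have hyz := hy z
  have huz := hu z
  rw [invSlash] at hyz huz
  have : (z : ℂ) ^ 2 * (y (ModularGroup.S • z) ^ 2 + b / c * u (ModularGroup.S • z) ^ 2) =
      (z * y (ModularGroup.S • z)) ^ 2 + b / c * (z * u (ModularGroup.S • z)) ^ 2 := by ring
  rw [this, hyz, huz]
  field_simp
  linear_combination (c * y z ^ 2 + b * u z ^ 2) * h1

theorem square_sum_vadd_one (hn : Odd n) (h : IsBasis n y u) (c : ℂ) (z : ℍ) :
    y ((1 : ℝ) +ᵥ z) ^ 2 + c * u ((1 : ℝ) +ᵥ z) ^ 2 = -(y z ^ 2 + c * u z ^ 2) := by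
  have key {s : ℂ} {v : ℍ → ℂ} (hv : HasNormalizedExpansion s v)
      (hs : Complex.exp (2 * π * Complex.I * (2 * s)) = -1) : v ((1 : ℝ) +ᵥ z) ^ 2 = -v z ^ 2 := by
    obtain ⟨f, A, hf, -, hvf⟩ := hasNormalizedExpansion_iff.mp hv
    have hq : qPow s ((1 : ℝ) +ᵥ z) ^ 2 = -qPow s z ^ 2 := by
      rw [qPow_pow, qPow_pow, qPow, qPow, coe_vadd, ← neg_one_mul, ← hs, ← Complex.exp_add]
      congr 1
      push_cast
      ring
    rw [hvf, hvf, hf.vadd_one, mul_pow, mul_pow, hq]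
    ring
  -- For n = 2l + 1, twice the exponent is l + 1/2 or (-l - 1) + 1/2, so squaring leaves the
  -- multiplier exp(πi) = -1.
  obtain ⟨l, rfl⟩ := hn
  have hexp (k : ℤ) : Complex.exp (π * Complex.I + k * (2 * π * Complex.I)) = -1 := by
    rw [Complex.exp_periodic.int_mul, Complex.exp_pi_mul_I]
  rw [key h.exp_left (by rw [← hexp (-l - 1)]; congr 1; push_cast; ring),
    key h.exp_right (by rw [← hexp l]; congr 1; push_cast; ring)]
  ring

end IsBasis

theorem exists_isBasis {n : ℕ} (hn : Odd n) : ∃ y u, IsBasis n y u := by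
  obtain ⟨y, hy1, hy2⟩ := exists_solution (n := n) (s := -(n : ℂ) / 4) (by ring)
    (half_le_norm_add hn (.inl rfl))
  obtain ⟨u, hu1, hu2⟩ := exists_solution (n := n) (s := (n : ℂ) / 4) (by ring)
    (half_le_norm_add hn (.inr rfl))
  exact ⟨y, u, hy1, hy2, hu1, hu2⟩

theorem exists_isAntiInvariantSquareSum {n : ℕ} (hn : Odd n) :
    ∃ F, IsAntiInvariantSquareSum (potential n) n F := by
  obtain ⟨y, u, h⟩ := exists_isBasis hn
  obtain ⟨c, hc⟩ := h.exists_square_sum hn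
  refine ⟨fun z ↦ y z ^ 2 + c * u z ^ 2, y, u, c, ⟨h.sol_left, h.exp_left⟩,
    ⟨h.sol_right, h.exp_right⟩, fun _ ↦ rfl, ?_, ?_⟩
  · funext z
    rw [slash_T_apply]
    exact h.square_sum_vadd_one hn c z
  · funext z
    rw [slash_S_apply, neg_neg, show (z : ℂ) ^ (2 : ℤ) = (z : ℂ) ^ 2 from zpow_natCast _ 2]
    rw [mul_comm]
    exact hc z

/-! ### Rationality of initial coefficients, and the series of Δ/q. -/

/-- The coefficients of `A` of index less than `N` are rational. -/
def IsRationalBelow (N : ℕ) (A : PowerSeries ℂ) : Prop := ∀ i < N, A.coeff i ∈ ratField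

namespace IsRationalBelow

variable {N : ℕ} {A B : PowerSeries ℂ}

theorem add (hA : IsRationalBelow N A) (hB : IsRationalBelow N B) : IsRationalBelow N (A + B) :=
  fun i hi ↦ by
    rw [map_add]
    exact add_mem (hA i hi) (hB i hi)

theorem sub (hA : IsRationalBelow N A) (hB : IsRationalBelow N B) : IsRationalBelow N (A - B) :=
  fun i hi ↦ by
    rw [map_sub]
    exact sub_mem (hA i hi) (hB i hi)

theorem smul {c : ℂ} (hc : c ∈ ratField) (hA : IsRationalBelow N A) : IsRationalBelow N (c • A) :=
  fun i hi ↦ by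
    rw [PowerSeries.coeff_smul]
    exact mul_mem hc (hA i hi)

theorem mul (hA : IsRationalBelow N A) (hB : IsRationalBelow N B) : IsRationalBelow N (A * B) :=
  fun i hi ↦ by
    rw [PowerSeries.coeff_mul]
    refine sum_mem fun p hp ↦ ?_
    have := Finset.HasAntidiagonal.mem_antidiagonal.mp hp
    exact mul_mem (hA _ (by lia)) (hB _ (by lia))

theorem one : IsRationalBelow N 1 := fun i _ ↦ by
  rw [PowerSeries.coeff_one]
  split_ifs
  exacts [one_mem _, zero_mem _]

theorem pow (hA : IsRationalBelow N A) (k : ℕ) : IsRationalBelow N (A ^ k) := by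
  induction k with
  | zero => simpa using one
  | succ k ih => simpa [pow_succ] using ih.mul hA

theorem of_mul_left (hA : IsRationalBelow N A) (h0 : A.coeff 0 = 1)
    (h : IsRationalBelow N (A * B)) : IsRationalBelow N B := by
  intro i
  induction i using Nat.strong_induction_on with
  | _ i ih =>
    intro hi
    have h1 := h i hi
    rw [PowerSeries.coeff_mul, Finset.Nat.sum_antidiagonal_eq_sum_range_succ
      (fun i j ↦ A.coeff i * B.coeff j), Finset.sum_range_succ', h0, one_mul] at h1
    refine (add_mem_cancel_left (sum_mem fun k hk ↦ ?_)).mp h1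
    have hk := Finset.mem_range.mp hk
    exact mul_mem (hA _ (by lia)) (ih _ (by lia) (by lia))

/-- The coefficient of index i + 1 in A² is 2 a₀ a_{i+1} plus products of earlier coefficients, so
it can be solved for a_{i+1}. -/
theorem of_mul_self (h0 : A.coeff 0 ∈ ratField) (h0' : A.coeff 0 ≠ 0)
    (h : IsRationalBelow N (A * A)) : IsRationalBelow N A := by
  intro i
  induction i using Nat.strong_induction_on with
  | _ i ih =>
    intro hi
    rcases i with - | i
    · exact h0
    have h1 := h _ hi
    rw [PowerSeries.coeff_mul, Finset.Nat.sum_antidiagonal_eq_sum_range_succ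
      (fun i j ↦ A.coeff i * A.coeff j), Finset.sum_range_succ', Finset.sum_range_succ,
      add_assoc, Nat.sub_self, Nat.sub_zero] at h1
    have h2 := (add_mem_cancel_left (sum_mem fun k hk ↦ ?_)).mp h1
    · rw [mul_comm, ← two_mul, ← mul_assoc] at h2
      have h3 := mul_mem (inv_mem (mul_mem (ofNat_mem ratField 2) h0)) h2
      rwa [inv_mul_cancel_left₀ (mul_ne_zero two_ne_zero h0')] at h3
    · have hk := Finset.mem_range.mp hk
      exact mul_mem (ih _ (by lia) (by lia)) (ih _ (by lia) (by lia))

end IsRationalBelow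

theorem coeff_series_E₆_mem (m : ℕ) : (qExpansion 1 E₆).coeff m ∈ ratField := by
  rw [EisensteinSeries.E_qExpansion_coeff _ ⟨3, rfl⟩]
  split_ifs
  · exact one_mem _
  · refine mul_mem (neg_mem (div_mem (mul_mem (ofNat_mem _ _) (natCast_mem _ _)) ?_))
      (natCast_mem _ _)
    exact ⟨bernoulli 6, by simp⟩

theorem hasQSeries_discriminant : HasQSeries discriminant (qExpansion 1 discriminant) :=
  hasQSeries_qExpansion CuspForm.discriminant

theorem isRationalBelow_discriminant (N : ℕ) : IsRationalBelow N (qExpansion 1 discriminant) := by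
  have h := ((hasQSeries_E₄.pow 3).sub ((hasQSeries_qExpansion E₆).pow 2)).const_mul (1 / 1728)
  rw [hasQSeries_discriminant.unique (h.congr fun z ↦ by
    rw [discriminant_eq_E₄_cube_sub_E₆_sq]
    ring)]
  refine .smul (div_mem (one_mem _) (ofNat_mem _ _)) (.sub (.pow ?_ 3) (.pow ?_ 2))
  · exact fun i _ ↦ coeff_seriesE₄_mem i
  · exact fun i _ ↦ coeff_series_E₆_mem i

/-- The `q`-expansion of `Δ / q`. -/
noncomputable def seriesDelta : PowerSeries ℂ :=
  PowerSeries.mk fun m ↦ (qExpansion 1 discriminant).coeff (m + 1)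

theorem coeff_zero_discriminant : (qExpansion 1 discriminant).coeff 0 = 0 :=
  CuspFormClass.qExpansion_coeff_zero CuspForm.discriminant one_pos one_mem_strictPeriods_SL

theorem X_mul_seriesDelta : PowerSeries.X * seriesDelta = qExpansion 1 discriminant := by
  ext m
  rcases m with - | m
  · rw [coeff_zero_discriminant, PowerSeries.coeff_zero_X_mul]
  · rw [PowerSeries.coeff_succ_X_mul, seriesDelta, PowerSeries.coeff_mk]

theorem coeff_zero_seriesDelta : seriesDelta.coeff 0 = 1 := by
  rw [seriesDelta, PowerSeries.coeff_mk]
  exact discriminant_qExpansion_coeff_one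

theorem isRationalBelow_seriesDelta (N : ℕ) : IsRationalBelow N seriesDelta := fun i _ ↦ by
  rw [seriesDelta, PowerSeries.coeff_mk]
  exact isRationalBelow_discriminant (i + 2) _ (by lia)

theorem hasQSeries_discriminant_div :
    HasQSeries (fun z ↦ discriminant z / qPow 1 z) seriesDelta := fun z ↦ by
  have h := (hasSum_nat_add_iff' 1).mpr (hasQSeries_discriminant z)
  simp only [Finset.range_one, Finset.sum_singleton, coeff_zero_discriminant, zero_mul,
    sub_zero] at h
  have hq : qPow 1 z = Periodic.qParam 1 (z : ℂ) := by simpa using qPow_natCast 1 z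
  have hne : Periodic.qParam 1 (z : ℂ) ≠ 0 := Periodic.qParam_ne_zero _
  change HasSum _ (discriminant z / qPow 1 z)
  rw [hq]
  refine (h.div_const (Periodic.qParam 1 (z : ℂ))).congr_fun fun m ↦ ?_
  rw [seriesDelta, PowerSeries.coeff_mk, pow_succ]
  field_simp

/-! ### Level one forms of weight 12l + 4 as polynomials in j. -/

/-- A level one form of weight `12 l + 4` is `E₄ Δ ^ l` times a polynomial in `j`, with rational
coefficients if the first `l + 1` coefficients of its `q`-expansion are rational. -/
theorem exists_polynomial (l : ℕ) {k : ℤ} (hk : k = 12 * l + 4) (G : ModularForm 𝒮ℒ k)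
    (hG : IsRationalBelow (l + 1) (qExpansion 1 G)) : ∃ P : Polynomial ℚ, P.natDegree ≤ l ∧
      (P.coeff l : ℂ) = (qExpansion 1 G).coeff 0 ∧
      ∀ z, G z = E₄ z * discriminant z ^ l * Polynomial.aeval (kleinJ z) P := by
  induction l generalizing k with
  | zero =>
    obtain ⟨r, hr⟩ := hG 0 one_pos
    obtain rfl : k = 4 := by simpa using hk
    have hcusp : (qExpansion 1 (G - (r : ℂ) • E₄)).coeff 0 = 0 := by
      have h := (hasQSeries_qExpansion G).sub (hasQSeries_E₄.const_mul r)
      rw [(h.congr (g := (G - (r : ℂ) • E₄)) fun z ↦ rfl).qExpansion_eq]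
      rw [map_sub, PowerSeries.coeff_smul, coeff_zero_seriesE₄, ← hr]
      simp
    -- A cusp form of weight 4 divided by Δ has weight -8, so it vanishes.
    have h0 := ModularFormClass.levelOne_neg_weight_eq_zero (by norm_num)
      (CuspForm.discriminantEquiv (toCuspForm (G - (r : ℂ) • E₄) hcusp))
    refine ⟨Polynomial.C r, by simp, by simpa using hr, fun z ↦ ?_⟩
    have h1 := congrFun (discriminant_mul_discriminantEquiv (toCuspForm (G - (r : ℂ) • E₄) hcusp)) z
    rw [h0, mul_zero] at h1
    have h2 : 0 = G z - r * E₄ z := h1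
    simp
    linear_combination -h2
  | succ l ih =>
    obtain ⟨r, hr⟩ := hG 0 (Nat.succ_pos _)
    -- E₄^{3l+4} has weight 12(l + 1) + 4, constant term 1, and equals E₄ Δ^{l+1} j^{l+1}: it
    -- contributes the leading monomial of P.
    let E : ModularForm 𝒮ℒ k := ModularForm.mcast (by subst hk; push_cast; ring) (E₄.pow (3 * l + 4))
    have hE (z : ℍ) : E z = E₄ z ^ (3 * l + 4) := by
      simp only [E, ModularForm.coe_mcast, ModularForm.coe_pow, Pi.pow_apply]
    have hser := (hasQSeries_qExpansion G).sub
      (((hasQSeries_E₄.pow (3 * l + 4)).congr hE).const_mul r)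
    have hq : qExpansion 1 (G - (r : ℂ) • E) = qExpansion 1 G - (r : ℂ) • seriesE₄ ^ (3 * l + 4) :=
      (hser.congr (g := (G - (r : ℂ) • E)) fun z ↦ rfl).qExpansion_eq
    have hcusp : (qExpansion 1 (G - (r : ℂ) • E)).coeff 0 = 0 := by
      have h0 := coeff_zero_seriesE₄
      rw [PowerSeries.coeff_zero_eq_constantCoeff_apply] at h0
      rw [hq, map_sub, PowerSeries.coeff_smul, PowerSeries.coeff_zero_eq_constantCoeff_apply
        (seriesE₄ ^ _), map_pow, h0, ← hr]
      simp
    have hfac := qExpansion_eq_qExpansion_discriminant_mul (G - (r : ℂ) • E) hcusp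
    have hmul := discriminant_mul_discriminantEquiv_apply (toCuspForm (G - (r : ℂ) • E) hcusp)
    have hrat : IsRationalBelow (l + 2) (qExpansion 1 (G - (r : ℂ) • E)) := by
      rw [hq]
      exact hG.sub (.smul ⟨r, rfl⟩ (.pow (fun i _ ↦ coeff_seriesE₄_mem i) _))
    set G' := CuspForm.discriminantEquiv (toCuspForm (G - (r : ℂ) • E) hcusp)
    have hrat' : IsRationalBelow (l + 1) (qExpansion 1 G') := by
      -- Division by Δ = q(1 + ⋯) costs exactly one coefficient of known rationality, matching the
      -- drop in l.
      refine .of_mul_left (isRationalBelow_seriesDelta _) coeff_zero_seriesDelta fun i hi ↦ ?_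
      have := hrat (i + 1) (by lia)
      change (PowerSeries.coeff (i + 1)) (qExpansion 1 (⇑(G - (r : ℂ) • E))) ∈ ratField at this
      rwa [hfac, ← X_mul_seriesDelta, mul_assoc, PowerSeries.coeff_succ_X_mul] at this
    obtain ⟨P, hPd, hPl, hP⟩ := ih (by subst hk; push_cast; ring) G' hrat'
    refine ⟨Polynomial.C r * Polynomial.X ^ (l + 1) + P, ?_, ?_, fun z ↦ ?_⟩
    · exact Polynomial.natDegree_add_le_of_degree_le (Polynomial.natDegree_C_mul_X_pow_le _ _)
        (hPd.trans l.le_succ)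
    · rw [Polynomial.coeff_add, Polynomial.coeff_C_mul_X_pow, if_pos rfl,
        Polynomial.coeff_eq_zero_of_natDegree_lt (Nat.lt_succ_of_le hPd), add_zero, ← hr]
      simp
    · have h1 := hmul z
      have h2 : (toCuspForm (G - (r : ℂ) • E) hcusp) z = G z - r * E z := rfl
      rw [h2, hP z, hE] at h1
      have h3 : discriminant z * kleinJ z = E₄ z ^ 3 :=
        mul_div_cancel₀ _ (discriminant_ne_zero z)
      have h4 : discriminant z ^ (l + 1) * kleinJ z ^ (l + 1) = E₄ z ^ (3 * l + 3) := by
        rw [← mul_pow, h3, ← pow_mul]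
        ring_nf
      simp only [map_add, map_mul, map_pow, Polynomial.aeval_C, Polynomial.aeval_X, eq_ratCast]
      linear_combination (-r * E₄ z) * h4 - h1

/-! ### Transformation of Δ^{1/2} and the polynomial for F. -/

theorem sqrtDelta_vadd_one (z : ℍ) : sqrtDelta ((1 : ℝ) +ᵥ z) = -sqrtDelta z := by
  have h (m : ℕ) : qPow (m + 1) ((1 : ℝ) +ᵥ z) = qPow (m + 1) z := by
    have h := qPow_natCast (m + 1)
    push_cast at h
    rw [h, h, qParam_vadd]
  have h2 : qPow (1 / 2) ((1 : ℝ) +ᵥ z) = -qPow (1 / 2) z := by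
    rw [qPow, qPow, coe_vadd, ← neg_one_mul, ← Complex.exp_pi_mul_I, ← Complex.exp_add]
    congr 1
    push_cast
    ring
  simp only [sqrtDelta_eq, h, h2]
  ring

theorem sqrt_pow_twelve (w : ℂ) : Complex.sqrt w ^ 12 = w ^ 6 := by
  have : Complex.sqrt w ^ 2 = w := Complex.cpow_ofNat_inv_pow w 2
  rw [show 12 = 2 * 6 by rfl, pow_mul, this]

theorem sqrtDelta_S_smul (z : ℍ) :
    sqrtDelta (ModularGroup.S • z) = -(z : ℂ) ^ 6 * sqrtDelta z := by
  have h := eta_comp_eq_csqrt_I_inv z.2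
  simp only [Function.comp_apply, Pi.smul_apply, Pi.mul_apply, smul_eq_mul] at h
  rw [sqrtDelta, coe_S_smul, show -(z : ℂ)⁻¹ = -1 / z by ring, h, mul_pow, mul_pow, inv_pow,
    sqrt_pow_twelve, sqrt_pow_twelve, show Complex.I ^ 6 = (Complex.I ^ 2) ^ 3 by ring,
    Complex.I_sq, sqrtDelta]
  norm_num

theorem mdiff_sqrtDelta : MDiff sqrtDelta := by
  rw [UpperHalfPlane.mdifferentiable_iff]
  refine .congr (fun z hz ↦ (differentiableAt_eta_of_mem_upperHalfPlaneSet hz).pow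
    12 |>.differentiableWithinAt) fun z hz ↦ ?_
  simp [sqrtDelta, ofComplex_apply_of_im_pos hz]

theorem discriminant_vadd_one (z : ℍ) : discriminant ((1 : ℝ) +ᵥ z) = discriminant z :=
  hasQSeries_discriminant.vadd_one z

theorem discriminant_S_smul (z : ℍ) :
    discriminant (ModularGroup.S • z) = (z : ℂ) ^ 12 * discriminant z := by
  rw [← (sqrtDelta_sq z).1, ← (sqrtDelta_sq _).1, sqrtDelta_S_smul]
  ring

theorem isBoundedAtImInfty_of_sq {f : ℍ → ℂ} (h : IsBoundedAtImInfty fun z ↦ f z ^ 2) :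
    IsBoundedAtImInfty f := by
  rw [isBoundedAtImInfty_iff] at h ⊢
  obtain ⟨M, A, h⟩ := h
  refine ⟨M + 1, A, fun z hz ↦ ?_⟩
  have := h z hz
  rw [norm_pow] at this
  nlinarith [sq_nonneg (‖f z‖ - 1 / 2)]

theorem exists_polynomial_of_isAntiInvariantSquareSum {n : ℕ} (hn : Odd n) {F : ℍ → ℂ}
    (hF : IsAntiInvariantSquareSum (potential n) n F) :
    ∃ P : Polynomial ℚ, P.degree = (((n - 1) / 2 : ℕ) : WithBot ℕ) ∧
      ∀ z, F z = E₄ z / sqrtDelta z * Polynomial.aeval (kleinJ z) P := by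
  obtain ⟨y, u, c, ⟨hy, hye⟩, ⟨hu, hue⟩, hFyu, hFT, hFS⟩ := hF
  obtain ⟨f, A, hf, hA0, hyf, hA⟩ := hy.exists_rational_series hn (.inl rfl) hye
  obtain ⟨g, B, hg, hB0, hug, hB⟩ := hu.exists_rational_series hn (.inr rfl) hue
  have hFT' (z : ℍ) : F ((1 : ℝ) +ᵥ z) = -F z := by
    rw [← slash_T_apply F (-2), hFT]
    rfl
  have hFS' (z : ℍ) : F (ModularGroup.S • z) * z ^ 2 = -F z := by
    have h := congrFun hFS z
    rw [slash_S_apply, neg_neg, show (z : ℂ) ^ (2 : ℤ) = (z : ℂ) ^ 2 from zpow_natCast _ 2] at h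
    exact h
  have hFd : MDiff F := by
    obtain ⟨y', hy', -⟩ := isSolution_iff.mp hy
    obtain ⟨u', hu', -⟩ := isSolution_iff.mp hu
    have := ((hy'.mul hy').add ((hu'.mul hu').const_mul c)).mdiff
    convert this using 2 with z
    rw [hFyu]
    ring
  obtain ⟨l, rfl⟩ := hn
  let n := 2 * l + 1
  let G : ℍ → ℂ := fun z ↦ F z * sqrtDelta z * discriminant z ^ l
  -- Squaring G replaces Δ^{1/2} by Δ, so only integral powers of q occur: G² = F² Δ^n, with q^{-n}
  -- from F² cancelling q^n from Δ^n. Boundedness, the constant term and rationality of G are all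
  -- read off from G².
  have hG2 : HasQSeries (fun z ↦ G z ^ 2)
      (seriesDelta ^ n * (A ^ 2 + c • (PowerSeries.X ^ n * B ^ 2)) ^ 2) := by
    refine ((hasQSeries_discriminant_div.pow n).mul (((hf.pow 2).add
      (((HasQSeries.X.pow n).mul (hg.pow 2)).const_mul c)).pow 2)).congr fun z ↦ ?_
    have hq := qPow_ne_zero 1 z
    have hΔ := (sqrtDelta_sq z).1
    have hQ : Periodic.qParam 1 (z : ℂ) ^ n = qPow ((n : ℂ) / 4) z ^ 4 := by
      rw [← qPow_natCast, qPow_pow]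
      congr 1
      push_cast
      ring
    have hQ1 : qPow 1 z ^ n = qPow ((n : ℂ) / 4) z ^ 4 := by
      rw [← hQ, ← qPow_natCast, qPow_pow, mul_one]
    have hinv : qPow (-(n : ℂ) / 4) z * qPow ((n : ℂ) / 4) z = 1 := by
      rw [← qPow_add, neg_div, neg_add_cancel, qPow_zero]
    have hGz : G z ^ 2 = F z ^ 2 * discriminant z ^ n := by
      simp only [G, n]
      rw [mul_pow, mul_pow, hΔ]
      ring
    rw [hGz, hFyu, hyf, hug, div_pow, hQ, hQ1]
    change ((qPow (-(n : ℂ) / 4) z * f z) ^ 2 + c * (qPow ((n : ℂ) / 4) z * g z) ^ 2) ^ 2 *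
      discriminant z ^ n = _
    rw [eq_inv_of_mul_eq_one_left hinv]
    field_simp [qPow_ne_zero]
  have hGS : G ∣[(12 * l + 4 : ℤ)] ModularGroup.S = G := by
    funext z
    rw [slash_S_apply]
    have hz := z.ne_zero
    have hpow : (z : ℂ) ^ (-(12 * l + 4 : ℤ)) * ((z : ℂ) ^ 12) ^ l * z ^ 4 = 1 := by
      rw [← pow_mul, mul_assoc, ← pow_add, zpow_neg,
        show (12 * l + 4 : ℤ) = (12 * l + 4 : ℕ) by push_cast; rfl, zpow_natCast]
      exact inv_mul_cancel₀ (pow_ne_zero _ hz)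
    simp only [G]
    rw [sqrtDelta_S_smul, discriminant_S_smul, mul_pow]
    have h1 := hFS' z
    linear_combination (F z * sqrtDelta z * discriminant z ^ l) * hpow -
      (z ^ 4 * sqrtDelta z * discriminant z ^ l * ((z : ℂ) ^ 12) ^ l *
        (z : ℂ) ^ (-(12 * l + 4 : ℤ))) * h1
  have hGT : G ∣[(12 * l + 4 : ℤ)] ModularGroup.T = G := by
    funext z
    rw [slash_T_apply]
    simp only [G]
    rw [hFT', sqrtDelta_vadd_one, discriminant_vadd_one]
    ring
  have hGd : MDiff G :=
    (hFd.mul mdiff_sqrtDelta).mul (hasQSeries_discriminant.mdiff.pow l)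
  let M := modularFormOfGenerators G hGS hGT hGd (isBoundedAtImInfty_of_sq hG2.bounded)
  have hM := hasQSeries_qExpansion M
  have hsq : qExpansion 1 M ^ 2 =
      seriesDelta ^ n * (A ^ 2 + c • (PowerSeries.X ^ n * B ^ 2)) ^ 2 :=
    (hM.pow 2).unique hG2
  have hcoeff : (qExpansion 1 M).coeff 0 ^ 2 = 1 := by
    have h := congrArg PowerSeries.constantCoeff hsq
    have hD := coeff_zero_seriesDelta
    rw [PowerSeries.coeff_zero_eq_constantCoeff_apply] at hA0 hD ⊢
    rw [map_pow] at h
    rw [h]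
    simp [hA0, hD, n]
  have hrat : IsRationalBelow n (qExpansion 1 M) := by
    refine .of_mul_self ?_ ?_ ?_
    · rcases sq_eq_one_iff.mp hcoeff with h | h <;> rw [h]
      exacts [one_mem _, neg_mem (one_mem _)]
    · exact fun h ↦ by simp [h] at hcoeff
    · rw [← sq, hsq]
      -- The unknown `c` is multiplied by q^n, hence is invisible below index n.
      refine .mul (.pow (isRationalBelow_seriesDelta n) n) (.pow (.add (.pow (fun i _ ↦ hA i) 2) ?_) 2)
      intro i hi
      rw [PowerSeries.coeff_smul, PowerSeries.coeff_X_pow_mul', if_neg (by lia), smul_zero]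
      exact zero_mem _
  -- Enough coefficients are rational because l + 1 ≤ 2l + 1 = n.
  obtain ⟨P, hPd, hPl, hP⟩ := exists_polynomial l rfl M fun i hi ↦ hrat i (by lia)
  refine ⟨P, ?_, fun z ↦ ?_⟩
  · rw [show (2 * l + 1 - 1) / 2 = l by lia]
    refine Polynomial.degree_eq_of_le_of_coeff_ne_zero
      (Polynomial.natDegree_le_iff_degree_le.mp hPd) fun h0 ↦ ?_
    rw [← hPl, h0] at hcoeff
    simp at hcoeff
  · have h1 : F z * sqrtDelta z * discriminant z ^ l =
        E₄ z * discriminant z ^ l * Polynomial.aeval (kleinJ z) P := hP z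
    have hd := pow_ne_zero l (discriminant_ne_zero z)
    have hs : sqrtDelta z ≠ 0 := fun h ↦ discriminant_ne_zero z (by
      rw [← (sqrtDelta_sq z).1, h]
      simp)
    rw [div_mul_eq_mul_div, eq_div_iff hs]
    refine mul_right_cancel₀ hd ?_
    linear_combination h1

end ModularODE

theorem corollary1p3 (n : ℕ) (hn : Odd n) :
    (∃ F : UpperHalfPlane → ℂ,
      ModularODE.IsAntiInvariantSquareSum (ModularODE.potential n) n F) ∧
    ∀ F : UpperHalfPlane → ℂ,
      ModularODE.IsAntiInvariantSquareSum (ModularODE.potential n) n F →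
      ∃ P : Polynomial ℚ, P.degree = (((n - 1) / 2 : ℕ) : WithBot ℕ) ∧
        ∀ z : UpperHalfPlane,
          F z = ModularForm.E₄ z / ModularODE.sqrtDelta z *
            Polynomial.aeval (ModularODE.kleinJ z) P :=
  ⟨ModularODE.exists_isAntiInvariantSquareSum hn,
    fun _ hF ↦ ModularODE.exists_polynomial_of_isAntiInvariantSquareSum hn hF⟩
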